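/- Let $n\ge 1$. Let $L_n$ be the linear octagonal-quadrilateral network consisting of $n$ octagons and $n$ quadrilaterals in alternating order, consecutive ones sharing an edge: its vertices are $(s,i)$ with $s\in\{0,1\}$ and $0\le i\le 4n$; $(s,i)$ is adjacent to $(s,i+1)$ for $0\le i<4n$; and $(0,i)$ is adjacent to $(1,i)$ exactly when $i\equiv 0$ or $3 \pmod 4$. Let the cylinder octagonal-quadrilateral network $Q'_n(8,4)$ be the simple graph on $8n$ vertices obtained from $L_n$ by identifying its two opposite end edges in order, i.e. $(s,4n)$ with $(s,0)$ for $s\in\{0,1\}$. For a connected graph $G$, let $r_{uv}$ be the resistance distance between the vertices $u,v$ (the effective resistance when every edge is a unit resistor), and let the Kirchhoff index $Kf(G)$ be the sum of $r_{uv}$ over all unordered pairs of distinct vertices. Put $\mu=15+4\sqrt{14}$ and $\nu=15-4\sqrt{14}$. Then $$Kf\big(Q'_n(8,4)\big)=\frac{32n^{3}-2n}{3}+\frac{36n^{2}\sqrt{14}}{7}\cdot\frac{\mu^{n}-\nu^{n}}{\mu^{n}+\nu^{n}-2}.$$ -/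

import Mathlib

/-- Each edge of the finite graph `G` is a unit resistor.  `IsUnitFlowPotential G a b v` says that
`v` is the electric potential when a unit current enters the network at `a` and leaves it at `b`:
by Ohm's law the current from `x` to an adjacent `y` is `v x - v y`, and by Kirchhoff's current law
the total current leaving `x` along the edges is the current injected at `x`. -/
def IsUnitFlowPotential {V : Type*} [Fintype V] (G : SimpleGraph V) (a b : V) (v : V → ℝ) : Prop :=
  open Classical in
  ∀ x, (∑ y, if G.Adj x y then v x - v y else 0) =
    (if x = a then 1 else 0) - (if x = b then 1 else 0)

open Classical in
/-- The resistance distance between `a` and `b`: the potential difference that drives a unit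
current from `a` to `b`.  It does not depend on the chosen potential (`resistance_eq`), and a
potential exists whenever `G` is connected (`exists_isUnitFlowPotential`). -/
noncomputable def resistance {V : Type*} [Fintype V] (G : SimpleGraph V) (a b : V) : ℝ :=
  if h : ∃ v, IsUnitFlowPotential G a b v then h.choose a - h.choose b else 0

/-- The Kirchhoff index: the sum of the resistance distances over all unordered pairs of vertices.
The sum over ordered pairs counts each unordered pair of distinct vertices twice, and the
diagonal terms vanish (see `kirchhoffIndex_eq_sum_lt`). -/
noncomputable def kirchhoffIndex {V : Type*} [Fintype V] (G : SimpleGraph V) : ℝ :=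
  (∑ a, ∑ b, resistance G a b) / 2

/-- The linear octagonal-quadrilateral network with `n` octagons and `n` quadrilaterals in
alternating order, consecutive ones sharing an edge.  It has two horizontal paths
`(0, 0), …, (0, 4n)` and `(1, 0), …, (1, 4n)`, and a vertical edge (rung) between `(0, i)` and
`(1, i)` whenever `i` is congruent to `0` or `3` modulo `4`.  The octagons lie between the rungs
`4k` and `4k + 3`, the quadrilaterals between the rungs `4k + 3` and `4k + 4`, for `k < n`. -/
def linearNetwork (n : ℕ) : SimpleGraph (Fin 2 × Fin (4 * n + 1)) where
  Adj p q :=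
    (p.1 = q.1 ∧ ((p.2 : ℕ) + 1 = q.2 ∨ (q.2 : ℕ) + 1 = p.2)) ∨
    (p.1 ≠ q.1 ∧ p.2 = q.2 ∧ ((p.2 : ℕ) % 4 = 0 ∨ (p.2 : ℕ) % 4 = 3))
  symm := ⟨fun p q h => by
    rcases h with ⟨h1, h2⟩ | ⟨h1, h2, h3⟩
    · exact Or.inl ⟨h1.symm, h2.symm⟩
    · exact Or.inr ⟨h1.symm, h2.symm, h2 ▸ h3⟩⟩
  loopless := ⟨fun p h => by
    rcases h with ⟨_, h⟩ | ⟨h, _⟩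
    · omega
    · exact h rfl⟩

/-- The identification of the two opposite end edges of the linear network in order: `(0, 4n)` is
identified with `(0, 0)` and `(1, 4n)` with `(1, 0)`; all other vertices stay distinct. -/
def glueEnds (n : ℕ) [NeZero n] (p : Fin 2 × Fin (4 * n + 1)) : Fin 2 × Fin (4 * n) :=
  (p.1, ⟨(p.2 : ℕ) % (4 * n), Nat.mod_lt _ (by have := NeZero.pos n; omega)⟩)

/-- The cylinder octagonal-quadrilateral network `Q'_n(8,4)`: the image of the linear network
under the identification of its opposite end edges. -/
def cylinderNetwork (n : ℕ) [NeZero n] : SimpleGraph (Fin 2 × Fin (4 * n)) :=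
  (linearNetwork n).map (glueEnds n)

open Classical in
theorem isUnitFlowPotential_iff_lapMatrix {V : Type*} [Fintype V] (G : SimpleGraph V) (a b : V)
    (v : V → ℝ) : IsUnitFlowPotential G a b v ↔
      (G.lapMatrix ℝ).mulVec v = Pi.single a 1 - Pi.single b 1 := by
  have key : ∀ x, (∑ y, if G.Adj x y then v x - v y else 0) = (G.lapMatrix ℝ).mulVec v x := by
    intro x
    rw [SimpleGraph.lapMatrix_mulVec_apply, ← Finset.sum_filter, Finset.sum_sub_distrib,
      ← SimpleGraph.neighborFinset_eq_filter]
    simp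
  unfold IsUnitFlowPotential
  rw [funext_iff]
  refine forall_congr' fun x => ?_
  rw [← key x]
  simp [Pi.single_apply]

theorem IsUnitFlowPotential.sub_eq {V : Type*} [Fintype V] {G : SimpleGraph V} {a b : V}
    {v w : V → ℝ} (hv : IsUnitFlowPotential G a b v) (hw : IsUnitFlowPotential G a b w) :
    v a - v b = w a - w b := by
  classical
  rw [isUnitFlowPotential_iff_lapMatrix] at hv hw
  have h : w ⬝ᵥ (G.lapMatrix ℝ).mulVec v = v ⬝ᵥ (G.lapMatrix ℝ).mulVec w := by
    rw [Matrix.dotProduct_mulVec, ← Matrix.mulVec_transpose, (G.isSymm_lapMatrix (R := ℝ)).eq,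
      dotProduct_comm]
  have e1 : w ⬝ᵥ (Pi.single a 1 - Pi.single b 1) = w a - w b := by
    simp [dotProduct_sub]
  have e2 : v ⬝ᵥ (Pi.single a 1 - Pi.single b 1) = v a - v b := by
    simp [dotProduct_sub]
  rw [hv, hw, e1, e2] at h
  exact h.symm

theorem resistance_eq {V : Type*} [Fintype V] {G : SimpleGraph V} {a b : V} {v : V → ℝ}
    (hv : IsUnitFlowPotential G a b v) : resistance G a b = v a - v b := by
  have h : ∃ v, IsUnitFlowPotential G a b v := ⟨v, hv⟩
  rw [resistance, dif_pos h]
  exact h.choose_spec.sub_eq hv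

theorem exists_isUnitFlowPotential {V : Type*} [Fintype V] {G : SimpleGraph V}
    (hG : G.Connected) (a b : V) : ∃ v, IsUnitFlowPotential G a b v := by
  classical
  simp only [isUnitFlowPotential_iff_lapMatrix]
  by_contra hne
  have hmem : (Pi.single a 1 - Pi.single b 1 : V → ℝ) ∉
      LinearMap.range (Matrix.toLin' (G.lapMatrix ℝ)) := by
    rintro ⟨v, hv⟩
    exact hne ⟨v, by simpa using hv⟩
  obtain ⟨f, hf, hle⟩ := Submodule.exists_le_ker_of_notMem hmem
  obtain ⟨w, rfl⟩ := (dotProductEquiv ℝ V).surjective f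
  have hw : (G.lapMatrix ℝ).mulVec w = 0 := by
    have h0 : ∀ u, w ⬝ᵥ (G.lapMatrix ℝ).mulVec u = 0 := by
      intro u
      have := hle ⟨u, rfl⟩
      simpa using this
    rw [← dotProduct_self_eq_zero]
    rw [← h0 ((G.lapMatrix ℝ).mulVec w), Matrix.dotProduct_mulVec w, ← Matrix.mulVec_transpose,
      (G.isSymm_lapMatrix (R := ℝ)).eq]
  rw [SimpleGraph.lapMatrix_mulVec_eq_zero_iff_forall_reachable] at hw
  apply hf
  simp [dotProduct_sub, hw a b (hG a b)]

theorem resistance_self {V : Type*} [Fintype V] (G : SimpleGraph V) (a : V) :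
    resistance G a a = 0 := by
  unfold resistance
  split_ifs <;> simp

theorem resistance_comm {V : Type*} [Fintype V] (G : SimpleGraph V) (a b : V) :
    resistance G a b = resistance G b a := by
  have neg : ∀ {a b : V} {v : V → ℝ}, IsUnitFlowPotential G a b v →
      IsUnitFlowPotential G b a (-v) := by
    classical
    intro a b v h
    rw [isUnitFlowPotential_iff_lapMatrix] at h ⊢
    rw [Matrix.mulVec_neg, h, neg_sub]
  by_cases h : ∃ v, IsUnitFlowPotential G a b v
  · obtain ⟨v, hv⟩ := h
    rw [resistance_eq hv, resistance_eq (neg hv)]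
    simp only [Pi.neg_apply]
    ring
  · have h' : ¬ ∃ v, IsUnitFlowPotential G b a v := fun ⟨v, hv⟩ => h ⟨_, neg hv⟩
    rw [resistance, resistance, dif_neg h, dif_neg h']

theorem kirchhoffIndex_eq_sum_lt {V : Type*} [Fintype V] [LinearOrder V] (G : SimpleGraph V) :
    kirchhoffIndex G = ∑ p : V × V with p.1 < p.2, resistance G p.1 p.2 := by
  have hsplit : ∀ a b : V, resistance G a b =
      (if a < b then resistance G a b else 0) + (if b < a then resistance G b a else 0) := by
    intro a b
    rcases lt_trichotomy a b with h | h | h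
    · simp [h, h.not_gt]
    · simp [h, resistance_self]
    · simp [h, h.not_gt, resistance_comm G a b]
  have h1 : ∑ a, ∑ b, resistance G a b = (∑ a, ∑ b, if a < b then resistance G a b else 0) +
      ∑ a, ∑ b, if b < a then resistance G b a else 0 := by
    rw [← Finset.sum_add_distrib]
    refine Finset.sum_congr rfl fun a _ => ?_
    rw [← Finset.sum_add_distrib]
    exact Finset.sum_congr rfl fun b _ => hsplit a b
  have h2 : (∑ a, ∑ b, if b < a then resistance G b a else 0) =
      ∑ a, ∑ b, if a < b then resistance G a b else 0 := Finset.sum_comm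
  rw [kirchhoffIndex, h1, h2, Finset.sum_filter, Fintype.sum_prod_type]
  ring

/-- Explicit adjacency in the cylinder network: horizontal neighbours on two cycles of length
`4n`, and a rung at each position congruent to `0` or `3` modulo `4`. -/
theorem cylinderNetwork_adj (n : ℕ) [NeZero n] (u v : Fin 2 × Fin (4 * n)) :
    (cylinderNetwork n).Adj u v ↔
      (u.1 = v.1 ∧ (((u.2 : ℕ) + 1) % (4 * n) = v.2 ∨ ((v.2 : ℕ) + 1) % (4 * n) = u.2)) ∨
      (u.1 ≠ v.1 ∧ u.2 = v.2 ∧ ((u.2 : ℕ) % 4 = 0 ∨ (u.2 : ℕ) % 4 = 3)) := by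
  have hn := NeZero.pos n
  have hmod : ∀ i : ℕ, i % (4 * n) % 4 = i % 4 := fun i => Nat.mod_mul_right_mod i 4 n
  have hlt : ∀ i : Fin (4 * n), (i : ℕ) % (4 * n) = i := fun i => Nat.mod_eq_of_lt i.2
  obtain ⟨s, i⟩ := u
  obtain ⟨t, j⟩ := v
  rw [cylinderNetwork, SimpleGraph.map_adj']
  constructor
  · rintro ⟨hne, ⟨s', i'⟩, ⟨t', j'⟩, h, hi, hj⟩
    simp only [glueEnds, Prod.mk.injEq, Fin.ext_iff] at hi hj
    obtain ⟨hs, hi⟩ := hi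
    obtain ⟨ht, hj⟩ := hj
    simp only [linearNetwork, ne_eq, Fin.ext_iff] at h
    simp only [ne_eq, Fin.ext_iff]
    rcases h with ⟨h1, h2 | h2⟩ | ⟨h1, h2, h3⟩
    · refine Or.inl ⟨by omega, Or.inl ?_⟩
      rw [← hi, ← hj, ← h2, Nat.mod_add_mod]
    · refine Or.inl ⟨by omega, Or.inr ?_⟩
      rw [← hi, ← hj, ← h2, Nat.mod_add_mod]
    · refine Or.inr ⟨by omega, by rw [← hi, ← hj, h2], ?_⟩
      rw [← hi, hmod]
      exact h3
  · have step : ∀ i j : Fin (4 * n), ((i : ℕ) + 1) % (4 * n) = j → i ≠ j := by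
      rintro i j h rfl
      have hi := i.2
      rcases Nat.lt_or_ge ((i : ℕ) + 1) (4 * n) with h' | h'
      · rw [Nat.mod_eq_of_lt h'] at h
        omega
      · have h'' : (i : ℕ) + 1 = 4 * n := by omega
        rw [h'', Nat.mod_self] at h
        omega
    rintro (⟨h1, h2 | h2⟩ | ⟨h1, h2, h3⟩)
    · refine ⟨fun h => step i j h2 (Prod.ext_iff.1 h).2,
        (s, ⟨i, by omega⟩), (t, ⟨i + 1, by omega⟩), Or.inl ⟨h1, Or.inl rfl⟩, ?_, ?_⟩
      · simp [glueEnds, hlt]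
      · simp only [glueEnds, Prod.mk.injEq, Fin.ext_iff]
        exact ⟨trivial, h2⟩
    · refine ⟨fun h => step j i h2 (Prod.ext_iff.1 h).2.symm,
        (s, ⟨j + 1, by omega⟩), (t, ⟨j, by omega⟩), Or.inl ⟨h1, Or.inr rfl⟩, ?_, ?_⟩
      · simp only [glueEnds, Prod.mk.injEq, Fin.ext_iff]
        exact ⟨trivial, h2⟩
      · simp [glueEnds, hlt]
    · refine ⟨fun h => h1 (Prod.ext_iff.1 h).1,
        (s, ⟨i, by omega⟩), (t, ⟨j, by omega⟩), Or.inr ⟨h1, ?_, h3⟩, ?_, ?_⟩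
      · simpa [Fin.ext_iff] using h2
      · simp [glueEnds, hlt]
      · simp [glueEnds, hlt]

theorem cylinderNetwork_connected (n : ℕ) [NeZero n] : (cylinderNetwork n).Connected := by
  have hn := NeZero.pos n
  have h4 : 0 < 4 * n := by omega
  have hrow : ∀ (s : Fin 2) (i : ℕ) (hi : i < 4 * n),
      (cylinderNetwork n).Reachable (s, ⟨0, h4⟩) (s, ⟨i, hi⟩) := by
    intro s i
    induction i with
    | zero => exact fun _ => SimpleGraph.Reachable.refl _
    | succ k ih =>
      intro hi
      refine (ih (by omega)).trans (SimpleGraph.Adj.reachable ?_)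
      rw [cylinderNetwork_adj]
      exact Or.inl ⟨rfl, Or.inl (Nat.mod_eq_of_lt hi)⟩
  have hcol : ∀ s : Fin 2,
      (cylinderNetwork n).Reachable ((0 : Fin 2), ⟨0, h4⟩) (s, ⟨0, h4⟩) := by
    intro s
    by_cases hs : s = 0
    · rw [hs]
    · refine SimpleGraph.Adj.reachable ?_
      rw [cylinderNetwork_adj]
      exact Or.inr ⟨fun h => hs h.symm, rfl, Or.inl rfl⟩
  have hall : ∀ u, (cylinderNetwork n).Reachable ((0 : Fin 2), ⟨0, h4⟩) u := fun u =>
    (hcol u.1).trans (hrow u.1 u.2 u.2.2)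
  have : Nonempty (Fin 2 × Fin (4 * n)) := ⟨(0, ⟨0, h4⟩)⟩
  exact ⟨fun u v => (hall u).symm.trans (hall v)⟩

/-! Swapping the two rows splits the Laplacian into the plain Laplacian of a cycle of length `4n`
(symmetric part) and that Laplacian plus the potential `rungWeight` (antisymmetric part). If `S` and
`A` are Green kernels of the two parts, then `G = (S ± A) / 2` is a Green function of the cylinder
up to a uniform background charge (`cylinderGreen_sum_adj`), and the resistance between `a` and `b`
is `G a a - G a b - G b a + G b b`. Summation gives `Kf = 8n · tr G - ∑ G`.

`S` is chosen to vanish on the diagonal, so `tr G` is the trace of `A`. The signs cancel in row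
sums, so `∑ G` depends on `S` alone and gives the polynomial term (`sum_symmKernel_cycleGreen`). `A`
is built from the two Floquet solutions of the antisymmetric equation, whose multipliers are `15 ±
4√14`; its trace (`sum_rungGreen_diag`) gives the other term. -/

/-! ### Floquet solutions of the antisymmetric equation -/

/-- A solution of the difference equation on `ℤ` which is multiplied by `15 + 4 √14` over each
period of length four; together with `decaySolution` it spans the solution space. -/
noncomputable def growthSolution (k : ℤ) : ℝ :=
  (15 + 4 * Real.sqrt 14) ^ (k / 4) * (Real.sqrt 14 - 3 + 2 * ((k % 4 : ℤ) : ℝ))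

/-- A solution of the difference equation on `ℤ` which is multiplied by `15 - 4 √14` over each
period of length four. -/
noncomputable def decaySolution (k : ℤ) : ℝ :=
  (15 - 4 * Real.sqrt 14) ^ (k / 4) * (Real.sqrt 14 + 3 - 2 * ((k % 4 : ℤ) : ℝ))

/-- Twice the indicator function of the rung positions. -/
def rungWeight (k : ℤ) : ℝ := if k % 4 = 0 ∨ k % 4 = 3 then 2 else 0

theorem sq_sqrt_fourteen : Real.sqrt 14 * Real.sqrt 14 = 14 :=
  Real.mul_self_sqrt (by norm_num)

theorem decayRate_pos : 0 < 15 - 4 * Real.sqrt 14 := by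
  nlinarith [sq_sqrt_fourteen, Real.sqrt_nonneg 14]

theorem decayRate_lt_one : 15 - 4 * Real.sqrt 14 < 1 := by
  nlinarith [sq_sqrt_fourteen, Real.sqrt_nonneg 14]

theorem growthRate_pos : 0 < 15 + 4 * Real.sqrt 14 := by positivity

theorem growthRate_mul_decayRate : (15 + 4 * Real.sqrt 14) * (15 - 4 * Real.sqrt 14) = 1 := by
  linear_combination (-16) * sq_sqrt_fourteen

theorem growthSolution_eq {k m r : ℤ} (hk : k = 4 * m + r) (h0 : 0 ≤ r) (h4 : r < 4) :
    growthSolution k = (15 + 4 * Real.sqrt 14) ^ m * (Real.sqrt 14 - 3 + 2 * (r : ℝ)) := by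
  rw [growthSolution, show k / 4 = m by omega, show k % 4 = r by omega]

theorem decaySolution_eq {k m r : ℤ} (hk : k = 4 * m + r) (h0 : 0 ≤ r) (h4 : r < 4) :
    decaySolution k = (15 - 4 * Real.sqrt 14) ^ m * (Real.sqrt 14 + 3 - 2 * (r : ℝ)) := by
  rw [decaySolution, show k / 4 = m by omega, show k % 4 = r by omega]

theorem rungWeight_eq {k m r : ℤ} (hk : k = 4 * m + r) :
    rungWeight k = if r % 4 = 0 ∨ r % 4 = 3 then 2 else 0 := by
  rw [rungWeight, show k % 4 = r % 4 by omega]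

theorem exists_four_mul_add (k : ℤ) :
    ∃ m : ℤ, k = 4 * m ∨ k = 4 * m + 1 ∨ k = 4 * m + 2 ∨ k = 4 * m + 3 :=
  ⟨k / 4, by omega⟩

/-- The position belongs to the preceding cell; writing the inverse multiplier as its conjugate
keeps the power at `m`. -/
theorem growthSolution_sub_one (m : ℤ) : growthSolution (4 * m - 1) =
    (15 + 4 * Real.sqrt 14) ^ m * (15 - 4 * Real.sqrt 14) * (Real.sqrt 14 + 3) := by
  rw [growthSolution_eq (m := m - 1) (r := 3) (by ring) (by norm_num) (by norm_num),
    zpow_sub_one₀ growthRate_pos.ne', ← eq_inv_of_mul_eq_one_right growthRate_mul_decayRate]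
  push_cast
  ring

theorem decaySolution_sub_one (m : ℤ) : decaySolution (4 * m - 1) =
    (15 - 4 * Real.sqrt 14) ^ m * (15 + 4 * Real.sqrt 14) * (Real.sqrt 14 - 3) := by
  rw [decaySolution_eq (m := m - 1) (r := 3) (by ring) (by norm_num) (by norm_num),
    zpow_sub_one₀ decayRate_pos.ne', ← eq_inv_of_mul_eq_one_left growthRate_mul_decayRate]
  push_cast
  ring

theorem growthSolution_zero (m : ℤ) : growthSolution (4 * m) =
    (15 + 4 * Real.sqrt 14) ^ m * (Real.sqrt 14 - 3) := by
  rw [growthSolution_eq (m := m) (r := 0) (by ring) (by norm_num) (by norm_num)]; simp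

theorem growthSolution_one (m : ℤ) : growthSolution (4 * m + 1) =
    (15 + 4 * Real.sqrt 14) ^ m * (Real.sqrt 14 - 1) := by
  rw [growthSolution_eq (m := m) (r := 1) (by ring) (by norm_num) (by norm_num)]; push_cast; ring

theorem growthSolution_two (m : ℤ) : growthSolution (4 * m + 2) =
    (15 + 4 * Real.sqrt 14) ^ m * (Real.sqrt 14 + 1) := by
  rw [growthSolution_eq (m := m) (r := 2) (by ring) (by norm_num) (by norm_num)]; push_cast; ring

theorem growthSolution_three (m : ℤ) : growthSolution (4 * m + 3) =
    (15 + 4 * Real.sqrt 14) ^ m * (Real.sqrt 14 + 3) := by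
  rw [growthSolution_eq (m := m) (r := 3) (by ring) (by norm_num) (by norm_num)]; push_cast; ring

theorem decaySolution_zero (m : ℤ) : decaySolution (4 * m) =
    (15 - 4 * Real.sqrt 14) ^ m * (Real.sqrt 14 + 3) := by
  rw [decaySolution_eq (m := m) (r := 0) (by ring) (by norm_num) (by norm_num)]; simp

theorem decaySolution_one (m : ℤ) : decaySolution (4 * m + 1) =
    (15 - 4 * Real.sqrt 14) ^ m * (Real.sqrt 14 + 1) := by
  rw [decaySolution_eq (m := m) (r := 1) (by ring) (by norm_num) (by norm_num)]; push_cast; ring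

theorem decaySolution_two (m : ℤ) : decaySolution (4 * m + 2) =
    (15 - 4 * Real.sqrt 14) ^ m * (Real.sqrt 14 - 1) := by
  rw [decaySolution_eq (m := m) (r := 2) (by ring) (by norm_num) (by norm_num)]; push_cast; ring

theorem decaySolution_three (m : ℤ) : decaySolution (4 * m + 3) =
    (15 - 4 * Real.sqrt 14) ^ m * (Real.sqrt 14 - 3) := by
  rw [decaySolution_eq (m := m) (r := 3) (by ring) (by norm_num) (by norm_num)]; push_cast; ring

theorem growthSolution_four (m : ℤ) : growthSolution (4 * m + 4) =
    (15 + 4 * Real.sqrt 14) ^ m * (15 + 4 * Real.sqrt 14) * (Real.sqrt 14 - 3) := by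
  rw [show 4 * m + 4 = 4 * (m + 1) by ring, growthSolution_zero, zpow_add_one₀ growthRate_pos.ne']

theorem decaySolution_four (m : ℤ) : decaySolution (4 * m + 4) =
    (15 - 4 * Real.sqrt 14) ^ m * (15 - 4 * Real.sqrt 14) * (Real.sqrt 14 + 3) := by
  rw [show 4 * m + 4 = 4 * (m + 1) by ring, decaySolution_zero, zpow_add_one₀ decayRate_pos.ne']

/-- Off the rungs the equation says that second differences vanish, so a solution is affine on each
octagon, say `a + 2r`. With multiplier `μ`, the two rung equations are `(3a - 2)μ = a + 6` and `3a +
20 = μa`; hence `a² + 6a - 5 = 0`, and `a = √14 - 3` gives `μ = 15 + 4√14`. The other root gives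
minus `decaySolution`. -/
theorem growthSolution_recurrence (k : ℤ) :
    (2 + rungWeight k) * growthSolution k - growthSolution (k + 1) - growthSolution (k - 1) =
      0 := by
  obtain ⟨m, rfl | rfl | rfl | rfl⟩ := exists_four_mul_add k
  · rw [rungWeight_eq (m := m) (r := 0) (by ring), growthSolution_zero, growthSolution_one,
      growthSolution_sub_one]
    norm_num
    linear_combination 4 * (15 + 4 * Real.sqrt 14) ^ m * sq_sqrt_fourteen
  · rw [rungWeight_eq (m := m) (r := 1) (by ring), growthSolution_one, add_sub_cancel_right,
      growthSolution_zero, add_assoc, one_add_one_eq_two, growthSolution_two]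
    norm_num
    ring
  · rw [rungWeight_eq (m := m) (r := 2) (by ring), growthSolution_two,
      show 4 * m + 2 - 1 = 4 * m + 1 by ring, show 4 * m + 2 + 1 = 4 * m + 3 by ring,
      growthSolution_one, growthSolution_three]
    norm_num
    ring
  · rw [rungWeight_eq (m := m) (r := 3) (by ring), growthSolution_three,
      show 4 * m + 3 - 1 = 4 * m + 2 by ring, show 4 * m + 3 + 1 = 4 * m + 4 by ring,
      growthSolution_two, growthSolution_four]
    norm_num
    linear_combination (-4) * (15 + 4 * Real.sqrt 14) ^ m * sq_sqrt_fourteen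

theorem decaySolution_recurrence (k : ℤ) :
    (2 + rungWeight k) * decaySolution k - decaySolution (k + 1) - decaySolution (k - 1) = 0 := by
  obtain ⟨m, rfl | rfl | rfl | rfl⟩ := exists_four_mul_add k
  · rw [rungWeight_eq (m := m) (r := 0) (by ring), decaySolution_zero, decaySolution_one,
      decaySolution_sub_one]
    norm_num
    linear_combination (-4) * (15 - 4 * Real.sqrt 14) ^ m * sq_sqrt_fourteen
  · rw [rungWeight_eq (m := m) (r := 1) (by ring), decaySolution_one, add_sub_cancel_right,
      decaySolution_zero, add_assoc, one_add_one_eq_two, decaySolution_two]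
    norm_num
    ring
  · rw [rungWeight_eq (m := m) (r := 2) (by ring), decaySolution_two,
      show 4 * m + 2 - 1 = 4 * m + 1 by ring, show 4 * m + 2 + 1 = 4 * m + 3 by ring,
      decaySolution_one, decaySolution_three]
    norm_num
    ring
  · rw [rungWeight_eq (m := m) (r := 3) (by ring), decaySolution_three,
      show 4 * m + 3 - 1 = 4 * m + 2 by ring, show 4 * m + 3 + 1 = 4 * m + 4 by ring,
      decaySolution_two, decaySolution_four]
    norm_num
    linear_combination 4 * (15 - 4 * Real.sqrt 14) ^ m * sq_sqrt_fourteen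

theorem growthRate_zpow_mul_decayRate_zpow (m : ℤ) :
    (15 + 4 * Real.sqrt 14) ^ m * (15 - 4 * Real.sqrt 14) ^ m = 1 := by
  rw [← mul_zpow, growthRate_mul_decayRate, one_zpow]

/-- The discrete Wronskian is constant; it normalises the jump of `rungGreen`. -/
theorem casoratian_eq (k : ℤ) :
    growthSolution (k - 1) * decaySolution k - growthSolution k * decaySolution (k - 1) =
      -(4 * Real.sqrt 14) := by
  obtain ⟨m, rfl | rfl | rfl | rfl⟩ := exists_four_mul_add k
  all_goals have h := growthRate_zpow_mul_decayRate_zpow m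
  · rw [growthSolution_zero, decaySolution_zero, growthSolution_sub_one, decaySolution_sub_one]
    linear_combination (-(4 * Real.sqrt 14)) * h + (15 + 4 * Real.sqrt 14) ^ m *
      (15 - 4 * Real.sqrt 14) ^ m * (-8 * Real.sqrt 14) * sq_sqrt_fourteen
  · rw [add_sub_cancel_right, growthSolution_zero, decaySolution_zero, growthSolution_one,
      decaySolution_one]
    linear_combination (-(4 * Real.sqrt 14)) * h
  · rw [show 4 * m + 2 - 1 = 4 * m + 1 by ring, growthSolution_two, decaySolution_two,
      growthSolution_one, decaySolution_one]
    linear_combination (-(4 * Real.sqrt 14)) * h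
  · rw [show 4 * m + 3 - 1 = 4 * m + 2 by ring, growthSolution_two, decaySolution_two,
      growthSolution_three, decaySolution_three]
    linear_combination (-(4 * Real.sqrt 14)) * h

theorem growthSolution_add_period (k : ℤ) (n : ℕ) :
    growthSolution (k + (4 * n : ℕ)) = (15 + 4 * Real.sqrt 14) ^ n * growthSolution k := by
  rw [growthSolution, growthSolution, show (k + (4 * n : ℕ)) / 4 = k / 4 + n by omega,
    show (k + (4 * n : ℕ)) % 4 = k % 4 by omega, zpow_add₀ growthRate_pos.ne', zpow_natCast]
  ring

theorem decaySolution_add_period (k : ℤ) (n : ℕ) :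
    decaySolution (k + (4 * n : ℕ)) = (15 - 4 * Real.sqrt 14) ^ n * decaySolution k := by
  rw [decaySolution, decaySolution, show (k + (4 * n : ℕ)) / 4 = k / 4 + n by omega,
    show (k + (4 * n : ℕ)) % 4 = k % 4 by omega, zpow_add₀ decayRate_pos.ne', zpow_natCast]
  ring

/-! ### Periodic Green kernels on a cycle -/

/-- `K` is a Green kernel, with background charge `c`, of the operator
`u ↦ (2 + q j) u j - u (j + 1) - u (j - 1)` on the cycle of length `M`; its values are the
`K i j` with `i ≤ j ≤ i + M`. -/
structure IsCycleKernel (M : ℕ) (q : ℤ → ℝ) (c : ℝ) (K : ℤ → ℤ → ℝ) : Prop where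
  recurrence : ∀ i j, (2 + q j) * K i j - K i (j + 1) - K i (j - 1) = c
  period : ∀ i j, K j (i + M) = K i j
  jump : ∀ i, K (i - 1) i - K i (i - 1) = -1

/-- The symmetric function determined by its values `K i j` for `i ≤ j`. -/
def symmKernel (K : ℤ → ℤ → ℝ) (i j : ℤ) : ℝ := if i ≤ j then K i j else K j i

theorem symmKernel_self (K : ℤ → ℤ → ℝ) (i : ℤ) : symmKernel K i i = K i i := by
  simp [symmKernel]

namespace IsCycleKernel

variable {M : ℕ} {q : ℤ → ℝ} {c : ℝ} {K : ℤ → ℤ → ℝ}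

/-- Going once around the cycle exchanges the two arguments, so the equation in the second becomes
one in the first. -/
theorem recurrence_left (hK : IsCycleKernel M q c K) (i j : ℤ) :
    (2 + q j) * K j i - K (j + 1) i - K (j - 1) i = c := by
  have h := hK.recurrence (i - M) j
  simpa only [← hK.period (i - M), sub_add_cancel] using h

/-- Off the diagonal all three values lie on one branch. On it, the value at `j - 1` comes from the
other branch, and `jump` measures the difference: this is the unit source. -/
theorem symmKernel_recurrence (hK : IsCycleKernel M q c K) (i j : ℤ) :
    (2 + q j) * symmKernel K i j - symmKernel K i (j + 1) - symmKernel K i (j - 1) =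
      c + if j = i then 1 else 0 := by
  rcases lt_trichotomy i j with h | rfl | h
  · simp only [symmKernel, if_pos h.le, if_pos (show i ≤ j + 1 by omega),
      if_pos (show i ≤ j - 1 by omega), if_neg h.ne', hK.recurrence, add_zero]
  · simp only [symmKernel, le_refl, if_true, if_pos (show i ≤ i + 1 by omega),
      if_neg (show ¬ i ≤ i - 1 by omega)]
    linear_combination hK.recurrence i i - hK.jump i
  · have e : symmKernel K i (j + 1) = K (j + 1) i := by
      rcases (show j + 1 ≤ i by omega).eq_or_lt with h' | h'
      · rw [h', symmKernel_self]
      · rw [symmKernel, if_neg (by omega)]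
    rw [e, symmKernel, if_neg h.not_ge, symmKernel, if_neg (show ¬ i ≤ j - 1 by omega),
      if_neg h.ne, hK.recurrence_left, add_zero]

theorem symmKernel_length (hK : IsCycleKernel M q c K) {i : ℤ} (h0 : 0 ≤ i) (hM : i < M) :
    symmKernel K i M = symmKernel K i 0 := by
  have h := hK.period 0 i
  rw [zero_add] at h
  rw [symmKernel, if_pos hM.le, symmKernel, h]
  split_ifs with h'
  · rw [le_antisymm h' h0]
  · rfl

theorem symmKernel_neg_one (hK : IsCycleKernel M q c K) {i : ℤ} (h0 : 0 ≤ i) (hM : i < M) :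
    symmKernel K i (-1) = symmKernel K i (M - 1) := by
  have h := hK.period (-1) i
  rw [show (-1 : ℤ) + M = M - 1 by ring] at h
  rw [symmKernel, if_neg (by omega), symmKernel, if_pos (by omega), h]

end IsCycleKernel

/-! ### The two explicit kernels -/

/-- The Green kernel of the cycle of length `M`. -/
noncomputable def cycleGreen (M : ℕ) (i j : ℤ) : ℝ := -((j - i) * (M - (j - i))) / (2 * M)

/-- The Green kernel of the cycle of length `4 n` with the potential `rungWeight`. -/
noncomputable def rungGreen (n : ℕ) (i j : ℤ) : ℝ :=
  (growthSolution i * decaySolution j + (15 - 4 * Real.sqrt 14) ^ n *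
    (decaySolution i * growthSolution j)) / (4 * Real.sqrt 14 * (1 - (15 - 4 * Real.sqrt 14) ^ n))

theorem isCycleKernel_cycleGreen {M : ℕ} (hM : M ≠ 0) :
    IsCycleKernel M (fun _ => 0) (-1 / M) (cycleGreen M) := by
  have h : (M : ℝ) ≠ 0 := Nat.cast_ne_zero.2 hM
  constructor
  · intro i j
    simp only [cycleGreen]
    push_cast
    field_simp
    ring
  · intro i j
    simp only [cycleGreen]
    push_cast
    ring
  · intro i
    simp only [cycleGreen]
    push_cast
    field_simp
    ring

theorem decayRate_pow_lt_one {n : ℕ} (hn : n ≠ 0) : (15 - 4 * Real.sqrt 14) ^ n < 1 :=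
  pow_lt_one₀ decayRate_pos.le decayRate_lt_one hn

theorem growthRate_pow_mul_decayRate_pow (n : ℕ) :
    (15 + 4 * Real.sqrt 14) ^ n * (15 - 4 * Real.sqrt 14) ^ n = 1 := by
  rw [← mul_pow, growthRate_mul_decayRate, one_pow]

/-- The kernel is the decaying Green function on `ℤ`, summed over the translates by multiples of
`4n`: the images on either side form geometric series of ratio `ν ^ n`, where `ν = 15 - 4√14`. -/
theorem isCycleKernel_rungGreen {n : ℕ} (hn : n ≠ 0) :
    IsCycleKernel (4 * n) rungWeight 0 (rungGreen n) := by
  have h1 : 1 - (15 - 4 * Real.sqrt 14) ^ n ≠ 0 := (sub_pos.2 (decayRate_pow_lt_one hn)).ne'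
  have h2 : 4 * Real.sqrt 14 ≠ 0 := by positivity
  constructor
  · intro i j
    simp only [rungGreen, mul_div_assoc', ← sub_div]
    rw [div_eq_zero_iff]
    left
    linear_combination growthSolution i * decaySolution_recurrence j +
      (15 - 4 * Real.sqrt 14) ^ n * decaySolution i * growthSolution_recurrence j
  · intro i j
    simp only [rungGreen, growthSolution_add_period, decaySolution_add_period]
    congr 1
    linear_combination decaySolution j * growthSolution i * growthRate_pow_mul_decayRate_pow n
  · intro i
    simp only [rungGreen, ← sub_div]
    rw [div_eq_iff (mul_ne_zero h2 h1)]
    linear_combination (1 - (15 - 4 * Real.sqrt 14) ^ n) * casoratian_eq i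

/-! ### Green function and resistances of the cylinder -/

/-- The sum over the neighbours in the cylinder network, for a function which is given by a
function on `ℤ` on each of the two cycles. -/
theorem cylinderNetwork_sum_adj (n : ℕ) [NeZero n] (w : Fin 2 → ℤ → ℝ)
    (hM : ∀ t, w t (4 * n : ℕ) = w t 0) (hneg : ∀ t, w t (-1) = w t ((4 * n : ℕ) - 1))
    (s : Fin 2) (i : Fin (4 * n)) :
    (open Classical in
      ∑ y, if (cylinderNetwork n).Adj (s, i) y then w s i - w y.1 y.2 else 0) =
      2 * w s i - w s (i + 1) - w s (i - 1) +
        rungWeight i / 2 * (w s i - w (1 - s) i) := by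
  classical
  have hn := NeZero.pos n
  have hi := i.2
  have hsucc : ∃ j : Fin (4 * n), (j : ℕ) = (i + 1) % (4 * n) ∧
      w s (i + 1) = w s j := by
    refine ⟨⟨(i + 1) % (4 * n), Nat.mod_lt _ (by omega)⟩, rfl, ?_⟩
    rcases Nat.lt_or_ge ((i : ℕ) + 1) (4 * n) with h | h
    · simp [Nat.mod_eq_of_lt h]
    · have h' : (i : ℕ) + 1 = 4 * n := by omega
      have h'' : ((i : ℕ) : ℤ) + 1 = (4 * n : ℕ) := by omega
      simp only [h', Nat.mod_self, h'', hM, Nat.cast_zero]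
  have hpred : ∃ j : Fin (4 * n), (j + 1) % (4 * n) = (i : ℕ) ∧
      w s (i - 1) = w s j := by
    rcases Nat.eq_zero_or_pos (i : ℕ) with h | h
    · refine ⟨⟨4 * n - 1, by omega⟩, ?_, ?_⟩
      · simp [h, Nat.sub_add_cancel (show 1 ≤ 4 * n by omega)]
      · rw [h, Nat.cast_zero, zero_sub, hneg]
        congr 1
        simp only
        omega
    · refine ⟨⟨i - 1, by omega⟩, ?_, ?_⟩
      · simp only [Nat.sub_add_cancel h, Nat.mod_eq_of_lt hi]
      · congr 1
        simp only
        omega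
  obtain ⟨a, ha, hwa⟩ := hsucc
  obtain ⟨b, hb, hwb⟩ := hpred
  have hmod : ∀ j : Fin (4 * n), ((j : ℕ) + 1 < 4 * n ∧ ((j : ℕ) + 1) % (4 * n) = j + 1) ∨
      ((j : ℕ) + 1 = 4 * n ∧ ((j : ℕ) + 1) % (4 * n) = 0) := by
    intro j
    have hj := j.2
    rcases Nat.lt_or_ge ((j : ℕ) + 1) (4 * n) with h | h
    · exact Or.inl ⟨h, Nat.mod_eq_of_lt h⟩
    · have h' : (j : ℕ) + 1 = 4 * n := by omega
      exact Or.inr ⟨h', by rw [h', Nat.mod_self]⟩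
  -- The cycle has length at least four, so no two horizontal edges are merged in the simple graph,
  -- even for `n = 1`.
  have hab : a ≠ b := by
    rintro rfl
    have := hmod a
    have := hmod i
    omega
  have huniq : ∀ j : Fin (4 * n), ((j : ℕ) + 1) % (4 * n) = i ↔ j = b := by
    intro j
    refine ⟨fun h => Fin.ext ?_, fun h => h ▸ hb⟩
    have := hmod j
    have := hmod b
    omega
  have hother : ∀ t : Fin 2, s ≠ t ↔ t = 1 - s := by
    clear hwa hwb
    revert s
    decide
  have hs : s ≠ 1 - s := (hother _).2 rfl
  have key : ∀ y : Fin 2 × Fin (4 * n),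
      (if (cylinderNetwork n).Adj (s, i) y then w s i - w y.1 y.2 else 0) =
        (if y = (s, a) then w s i - w y.1 y.2 else 0) +
        (if y = (s, b) then w s i - w y.1 y.2 else 0) +
        (if y = (1 - s, i) then rungWeight i / 2 * (w s i - w y.1 y.2) else 0) := by
    rintro ⟨t, j⟩
    rw [cylinderNetwork_adj]
    simp only [huniq, ← ha, hother, Prod.mk.injEq, rungWeight]
    have e1 : ((i : ℕ) % 4 = 0 ∨ (i : ℕ) % 4 = 3) ↔
        (((i : ℕ) : ℤ) % 4 = 0 ∨ ((i : ℕ) : ℤ) % 4 = 3) := by omega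
    simp only [← e1, Fin.val_inj]
    by_cases ht : s = t
    · subst ht
      by_cases h1 : j = a
      · subst h1
        simp [hs, hab]
      · by_cases h2 : j = b
        · subst h2
          simp [hs, h1]
        · simp [hs, h1, h2, Ne.symm h1]
    · have ht' := (hother t).1 ht
      subst ht'
      by_cases h3 : j = i
      · subst h3
        by_cases h4 : (j : ℕ) % 4 = 0 ∨ (j : ℕ) % 4 = 3 <;> simp [hs, hs.symm, h4]
      · simp [hs, hs.symm, h3, Ne.symm h3]
  simp only [key, Finset.sum_add_distrib, Finset.sum_ite_eq', Finset.mem_univ, if_true]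
  rw [hwa, hwb]
  ring

/-- The Green function of the cylinder network: half the sum or half the difference of the Green
kernels of the symmetric and of the antisymmetric part of the Laplacian. -/
noncomputable def cylinderGreen (n : ℕ) (a : Fin 2 × ℤ) (t : Fin 2) (j : ℤ) : ℝ :=
  (symmKernel (cycleGreen (4 * n)) a.2 j +
    (if a.1 = t then 1 else -1) * symmKernel (rungGreen n) a.2 j) / 2

/-- On the row of `a` the two unit sources add up and are halved; on the other row they cancel. The
charge is half of `-1 / (4n)`. -/
theorem cylinderGreen_sum_adj (n : ℕ) [NeZero n] (a x : Fin 2 × Fin (4 * n)) :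
    (open Classical in
      ∑ y, if (cylinderNetwork n).Adj x y then
        cylinderGreen n (a.1, a.2) x.1 x.2 - cylinderGreen n (a.1, a.2) y.1 y.2 else 0) =
      (if x = a then 1 else 0) - 1 / (8 * n) := by
  have hn := NeZero.ne n
  have hS := isCycleKernel_cycleGreen (M := 4 * n) (by omega)
  have hA := isCycleKernel_rungGreen hn
  obtain ⟨s, i⟩ := x
  obtain ⟨t, k⟩ := a
  have h0 : (0 : ℤ) ≤ k := by omega
  have hM : (k : ℤ) < (4 * n : ℕ) := by omega
  rw [cylinderNetwork_sum_adj n (cylinderGreen n (t, k))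
    (fun t => by simp only [cylinderGreen, hS.symmKernel_length h0 hM,
      hA.symmKernel_length h0 hM])
    (fun t => by simp only [cylinderGreen, hS.symmKernel_neg_one h0 hM,
      hA.symmKernel_neg_one h0 hM])]
  have eS := hS.symmKernel_recurrence k i
  have eA := hA.symmKernel_recurrence k i
  have hki : ((i : ℕ) : ℤ) = (k : ℕ) ↔ i = k := by rw [Nat.cast_inj, Fin.val_inj]
  have hc : (-1 : ℝ) / ((4 * n : ℕ) : ℝ) = -2 * (1 / (8 * n)) := by
    push_cast
    have : (n : ℝ) ≠ 0 := Nat.cast_ne_zero.2 hn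
    field_simp
    norm_num
  rw [hc] at eS
  simp only [hki] at eS eA
  simp only [cylinderGreen, Prod.mk.injEq]
  have hcases : (t = s ∧ ¬ t = 1 - s ∧ s = t) ∨ (¬ t = s ∧ t = 1 - s ∧ ¬ s = t) := by
    revert s t
    decide
  rcases hcases with ⟨h1, h2, h3⟩ | ⟨h1, h2, h3⟩
  · rw [if_pos h1, if_neg h2]
    simp only [h3, true_and]
    linear_combination (eS + eA) / 2
  · rw [if_neg h1, if_pos h2]
    simp only [h3, false_and, if_false]
    linear_combination (eS - eA) / 2

theorem cylinderNetwork_resistance_eq (n : ℕ) [NeZero n] (a b : Fin 2 × Fin (4 * n)) :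
    resistance (cylinderNetwork n) a b =
      cylinderGreen n (a.1, a.2) a.1 a.2 - cylinderGreen n (b.1, b.2) a.1 a.2 -
        (cylinderGreen n (a.1, a.2) b.1 b.2 - cylinderGreen n (b.1, b.2) b.1 b.2) := by
  classical
  refine resistance_eq
    (v := fun y : Fin 2 × Fin (4 * n) =>
      cylinderGreen n (a.1, a.2) y.1 y.2 - cylinderGreen n (b.1, b.2) y.1 y.2) ?_
  intro x
  have ha := cylinderGreen_sum_adj n a x
  have hb := cylinderGreen_sum_adj n b x
  have h := congrArg₂ (· - ·) ha hb
  simp only [← Finset.sum_sub_distrib] at h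
  convert h using 1
  · refine Finset.sum_congr rfl fun y _ => ?_
    split_ifs <;> ring
  -- The background charges of the two sources cancel.
  · rw [sub_sub_sub_cancel_right]
    congr

/-! ### Row sums and trace -/

theorem sum_symmKernel_cycleGreen {M : ℕ} (i : Fin M) :
    ∑ j : Fin M, symmKernel (cycleGreen M) i j = -((M : ℝ) ^ 2 - 1) / 12 := by
  have hM : (M : ℝ) ≠ 0 := Nat.cast_ne_zero.2 (by have := i.2; omega)
  have hi : (i : ℕ) ≤ M := i.2.le
  rw [Fin.sum_univ_eq_sum_range (fun j => symmKernel (cycleGreen M) i j) M]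
  have hlow : ∀ k : ℕ, k ≤ i → ∑ j ∈ Finset.range k, symmKernel (cycleGreen M) i j =
      ∑ j ∈ Finset.range k, cycleGreen M j i := by
    intro k hk
    refine Finset.sum_congr rfl fun j hj => ?_
    have := Finset.mem_range.1 hj
    rw [symmKernel, if_neg (by omega)]
  -- Sum of `(i - j)(M - (i - j)) = i(M - i) + j(2i - M) - j²` over `j < k`, using the formulas for
  -- sums of powers.
  have low : ∀ k : ℕ, ∑ j ∈ Finset.range k, cycleGreen M j i =
      -(k * (i * (M - i)) + k * (k - 1) / 2 * (2 * i - M) - (k - 1) * k * (2 * k - 1) / 6) /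
        (2 * M) := by
    intro k
    induction k with
    | zero => simp
    | succ k ih =>
      rw [Finset.sum_range_succ, ih, cycleGreen]
      push_cast
      ring
  have high : ∀ k : ℕ, ∑ j ∈ Finset.range k, symmKernel (cycleGreen M) i (i + j : ℕ) =
      -(k * (k - 1) / 2 * M - (k - 1) * k * (2 * k - 1) / 6) / (2 * M) := by
    intro k
    induction k with
    | zero => simp
    | succ k ih =>
      rw [Finset.sum_range_succ, ih, symmKernel, if_pos (by omega), cycleGreen]
      push_cast
      ring
  obtain ⟨d, hd⟩ := Nat.exists_eq_add_of_le hi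
  have hd' : (d : ℝ) = M - i := by
    have := congrArg (Nat.cast : ℕ → ℝ) hd
    push_cast at this
    linarith
  rw [show Finset.range M = Finset.range (i + d) by rw [← hd], Finset.sum_range_add,
    hlow _ le_rfl, low, high, hd']
  field_simp
  ring

/-- On the diagonal the powers of the two multipliers cancel, so each cell contributes `∑ (14 - (3 -
2r)²) = 36` over `r = 0, 1, 2, 3`. -/
theorem sum_rungGreen_diag {n : ℕ} (hn : n ≠ 0) :
    ∑ i : Fin (4 * n), rungGreen n i i =
      9 * n * Real.sqrt 14 / 14 * ((1 + (15 - 4 * Real.sqrt 14) ^ n) /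
        (1 - (15 - 4 * Real.sqrt 14) ^ n)) := by
  have h1 : 1 - (15 - 4 * Real.sqrt 14) ^ n ≠ 0 := (sub_pos.2 (decayRate_pow_lt_one hn)).ne'
  have h2 : Real.sqrt 14 ≠ 0 := by positivity
  have hprod : ∀ k : ℕ, ∑ i ∈ Finset.range (4 * k), growthSolution i * decaySolution i =
      36 * k := by
    intro k
    induction k with
    | zero => simp
    | succ k ih =>
      rw [show 4 * (k + 1) = 4 * k + 1 + 1 + 1 + 1 by ring]
      simp only [Finset.sum_range_succ, ih]
      have h := growthRate_zpow_mul_decayRate_zpow k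
      push_cast
      rw [growthSolution_zero, growthSolution_one, growthSolution_two, growthSolution_three,
        decaySolution_zero, decaySolution_one, decaySolution_two, decaySolution_three]
      linear_combination (4 * Real.sqrt 14 ^ 2 - 20) * h + 4 * sq_sqrt_fourteen
  rw [Fin.sum_univ_eq_sum_range (fun i => rungGreen n i i) (4 * n)]
  have e : ∀ i : ℕ, rungGreen n i i = growthSolution i * decaySolution i *
      ((1 + (15 - 4 * Real.sqrt 14) ^ n) /
        (4 * Real.sqrt 14 * (1 - (15 - 4 * Real.sqrt 14) ^ n))) := by
    intro i
    rw [rungGreen]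
    ring
  simp only [e, ← Finset.sum_mul, hprod]
  field_simp
  linear_combination (-36) * (1 + (15 - 4 * Real.sqrt 14) ^ n) * sq_sqrt_fourteen

theorem cylinderGreen_diag (n : ℕ) (s : Fin 2) (i : ℤ) :
    cylinderGreen n (s, i) s i = rungGreen n i i / 2 := by
  simp [cylinderGreen, symmKernel_self, cycleGreen]

/-- The antisymmetric part cancels between the two rows. -/
theorem sum_cylinderGreen (n : ℕ) (a : Fin 2 × Fin (4 * n)) :
    ∑ b : Fin 2 × Fin (4 * n), cylinderGreen n (a.1, a.2) b.1 b.2 =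
      -((4 * n : ℝ) ^ 2 - 1) / 12 := by
  have h := sum_symmKernel_cycleGreen a.2
  have e : ∀ s : Fin 2, (∑ t : Fin 2, if s = t then (1 : ℝ) else -1) = 0 := by
    intro s
    fin_cases s <;> simp
  rw [Fintype.sum_prod_type_right]
  push_cast at h
  rw [← h]
  refine Finset.sum_congr rfl fun j _ => ?_
  simp only [cylinderGreen, ← Finset.sum_div, Finset.sum_add_distrib, ← Finset.sum_mul, e]
  simp

/-! ### The Kirchhoff index -/

theorem kirchhoffIndex_cylinderNetwork (n : ℕ) [NeZero n] :
    kirchhoffIndex (cylinderNetwork n) = (32 * (n : ℝ) ^ 3 - 2 * n) / 3 +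
      8 * n * ∑ i : Fin (4 * n), rungGreen n i i := by
  have htr : ∑ a : Fin 2 × Fin (4 * n), cylinderGreen n (a.1, a.2) a.1 a.2 =
      ∑ i : Fin (4 * n), rungGreen n i i := by
    rw [Fintype.sum_prod_type_right]
    refine Finset.sum_congr rfl fun i _ => ?_
    rw [Fin.sum_univ_two, cylinderGreen_diag, cylinderGreen_diag]
    ring
  have hcard : Fintype.card (Fin 2 × Fin (4 * n)) = 8 * n := by
    simp only [Fintype.card_prod, Fintype.card_fin]
    ring
  simp only [kirchhoffIndex, cylinderNetwork_resistance_eq, Finset.sum_sub_distrib,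
    sum_cylinderGreen, Finset.sum_const, Finset.card_univ, hcard, htr, nsmul_eq_mul,
    ← Finset.mul_sum]
  -- One cross term is summed over its source, so the order is exchanged to reach the same row sums.
  rw [Finset.sum_comm]
  simp only [sum_cylinderGreen, Finset.sum_const, Finset.card_univ, hcard, nsmul_eq_mul]
  push_cast
  ring

theorem mainTheorem2 (n : ℕ) [NeZero n] (μ ν : ℝ)
    (hμ : μ = 15 + 4 * Real.sqrt 14) (hν : ν = 15 - 4 * Real.sqrt 14) :
    kirchhoffIndex (cylinderNetwork n) =
      (32 * (n : ℝ) ^ 3 - 2 * n) / 3 +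
        36 * (n : ℝ) ^ 2 * Real.sqrt 14 / 7 * ((μ ^ n - ν ^ n) / (μ ^ n + ν ^ n - 2)) := by
  subst hμ hν
  have hn := NeZero.ne n
  have hlt := decayRate_pow_lt_one hn
  have hpos := pow_pos decayRate_pos n
  have hone := growthRate_pow_mul_decayRate_pow n
  rw [kirchhoffIndex_cylinderNetwork, sum_rungGreen_diag hn]
  generalize (15 + 4 * Real.sqrt 14) ^ n = x at *
  generalize (15 - 4 * Real.sqrt 14) ^ n = y at *
  have hx : x = y⁻¹ := eq_inv_of_mul_eq_one_left hone
  have h1 : 1 - y ≠ 0 := (sub_pos.2 hlt).ne'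
  have h2 : x + y - 2 ≠ 0 := by
    have : x + y - 2 = (1 - y) ^ 2 / y := by
      rw [hx]
      field_simp
      ring
    rw [this]
    positivity
  -- Since `xy = 1`, multiplying numerator and denominator by `x - 1` gives the symmetric form.
  have hF : (1 + y) / (1 - y) = (x - y) / (x + y - 2) := by
    rw [div_eq_div_iff h1 h2]
    linear_combination 2 * hone
  rw [hF]
  ring
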